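/- All logarithms are to base 2. Let $n=2^L$ be a power of two. A Zigzag hash table $\mathrm{ZHT}_{n,k,c}$ consists of $k$ tables $H_1,\dots,H_k$, each with $n$ buckets (with indices $0,\dots,n-1$, written in binary) of $c$ slots, and of hash functions $h_1,\dots,h_k$, where $h_i$ gives the destination bucket of an element in $H_i$. All hash functions below are independent and truly random, i.e. they assign independent uniformly random buckets to distinct elements. *Throw.* To throw an element $e$ into tables $H_s,\dots,H_k$ with hash functions $g_s,\dots,g_k$ means to put it into the first $H_j$, $j=s,\dots,k$, whose bucket $g_j(e)$ is not full; if there is no such $j$, then $e$ does not find a spot. A list of elements is thrown by throwing its elements one after the other. *Probabilistic routing network.* Given a table and a destination function $h$, all elements are first tagged $\mathsf{true}$. For $i=1,\dots,\log n$, stage $i$ re-partitions every pair of buckets whose indices differ exactly in the $i$th lowest bit: for $v\in\{0,1\}$, among the elements of the pair tagged $\mathsf{true}$ whose destination has $i$th bit $v$, $c$ (all of them, if there are at most $c$) are chosen uniformly at random and moved to the bucket of the pair whose $i$th bit is $v$; the others are retagged $\mathsf{false}$, and all elements tagged $\mathsf{false}$ are put into the free slots of the two buckets. After the last stage, the elements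 tagged $\mathsf{true}$ are in their destination buckets; the others are called spilled. *Oblivious insertion.* First, $n$ elements with distinct keys are thrown into the empty tables $H_1,\dots,H_k$ with fresh random hash functions (independent of $h_1,\dots,h_k$). Then, for $i=1,\dots,k$, the table $H_i$ is routed according to $h_i$, the elements that reached their destination stay in $H_i$, and the spilled elements are removed from $H_i$ and thrown, in the order of their positions in the output of the network, into $H_{i+1},\dots,H_k$ with fresh random hash functions (the throws of all other entries of $H_i$ are only pretended and change nothing). The insertion fails if some element does not find a spot in one of the throws, or if some element is spilled in the routing of $H_k$; otherwise it succeeds. **Theorem.** If $k$ and $c$ are of order $\log\log n$, then the oblivious insertion of $n$ elements into $\mathrm{ZHT}_{n,k,c}$ succeeds with very high probability, i.e. with probability at least $1-2^{-\lambda}$ for every fixed security parameter $\lambda$ and all sufficiently large $n$. Precisely: for every real $\varepsilon>0$ and every $\lambda\in\mathbb{N}$ there is $n_0$ such that for every power of two $n\ge n_0$ and all integers $k,c\ge 0$ with $k\ge\varepsilon\log\log n$ and $c\ge\varepsilon\log\log n$ (for instance $k=c=\lceil\log\log n\rceil$, or any larger constant multiple), the oblivious insertion of $n$ elements into $\mathrm{ZHT}_{n,k,c}$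 succeeds with probability at least $1-2^{-\lambda}$. -/

import Mathlib

namespace Zigzag

/-- The `n = 2 ^ L` elements to be inserted. Their keys are distinct, so that a truly random hash
function assigns them independent uniform buckets; hence only their indices matter. -/
abbrev Elem (L : ℕ) : Type := Fin (2 ^ L)

/-- Indices of the `n = 2 ^ L` buckets of a table, written in binary: `b i` is the bit of weight
`2 ^ i`, so that bit `0` is the lowest one. -/
abbrev Bucket (L : ℕ) : Type := Fin L → Bool

/-- The buckets in increasing order of their indices `0, 1, …, 2 ^ L - 1`. -/
def allBuckets (L : ℕ) : List (Bucket L) :=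
  (List.finRange (2 ^ L)).map fun x i => x.val.testBit i

/-- A hash table with `2 ^ L` buckets, each holding a list of elements. (The procedures below never
put more than `c` elements into a bucket, where `c` is the bucket size.) -/
abbrev Table (L : ℕ) : Type := Bucket L → List (Elem L)

/-! ### The probabilistic routing network -/

/-- The content of the network between two stages: every element carries a Boolean tag, which is
`true` as long as the element has not been spilled. -/
abbrev Network (L : ℕ) : Type := Bucket L → List (Elem L × Bool)

/-- Choose `c` of the elements of `xs` (all of them if there are at most `c`): those of least
priority. For a uniformly random permutation `prio` this is a uniformly random choice,
independently for disjoint lists. -/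
def choose {L : ℕ} (c : ℕ) (prio : Equiv.Perm (Elem L)) (xs : List (Elem L)) : List (Elem L) :=
  xs.filter fun e => decide ((xs.filter fun e' => decide (prio e' < prio e)).length < c)

/-- Re-partition of the two buckets with contents `pool` (concatenated) according to bit `i` of the
destination `h`. Of the elements tagged `true` whose destination has bit `v` at position `i`, at
most `c` are chosen at random and go to the bucket number `v`. All the others are tagged `false`
(or were so already) and fill the free slots, first those of bucket `0`, then those of
bucket `1`. -/
def repartition {L : ℕ} (c : ℕ) (h : Elem L → Bucket L) (prio : Equiv.Perm (Elem L)) (i : Fin L)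
    (pool : List (Elem L × Bool)) : List (Elem L × Bool) × List (Elem L × Bool) :=
  let kept : Bool → List (Elem L) := fun v =>
    choose c prio ((pool.filter fun x => x.2 && (h x.1 i == v)).map Prod.fst)
  let dead : List (Elem L) :=
    (pool.filter fun x => !(x.2 && decide (x.1 ∈ kept (h x.1 i)))).map Prod.fst
  let free : ℕ := c - (kept false).length
  ((kept false).map (fun e => (e, true)) ++ (dead.take free).map (fun e => (e, false)),
   (dead.drop free).map (fun e => (e, false)) ++ (kept true).map (fun e => (e, true)))

/-- The stage of the network that belongs to bit `i`: every pair of buckets whose indices differ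
exactly in bit `i` is re-partitioned. -/
def stage {L : ℕ} (c : ℕ) (h : Elem L → Bucket L) (prio : Equiv.Perm (Elem L))
    (N : Network L) (i : Fin L) : Network L := fun b =>
  let r := repartition c h prio i
    (N (Function.update b i false) ++ N (Function.update b i true))
  if b i then r.2 else r.1

/-- The routing network: the `L = log n` stages, from the lowest bit to the highest, applied to a
table all of whose elements are tagged `true`. -/
def route {L : ℕ} (c : ℕ) (h : Elem L → Bucket L) (prio : Fin L → Equiv.Perm (Elem L))
    (T : Table L) : Network L :=
  (List.finRange L).foldl (fun N i => stage c h (prio i) N i) fun b => (T b).map fun e => (e, true)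

/-- The elements tagged `true`, i.e. those that were routed to their destination. -/
def routed {L : ℕ} (N : Network L) : Table L := fun b =>
  ((N b).filter fun x => x.2).map Prod.fst

/-- The elements tagged `false`, in the order in which a scan of the buckets meets them. -/
def spilled {L : ℕ} (N : Network L) : List (Elem L) :=
  (allBuckets L).flatMap fun b => ((N b).filter fun x => !x.2).map Prod.fst

/-! ### The oblivious setup of a Zigzag hash table -/

/-- The `k` tables, and the elements that did not find a spot in any of them. -/
structure State (L k : ℕ) where
  tables : Fin k → Table L
  lost : List (Elem L)

/-- Throw `e` into the tables `s, s + 1, …, k - 1` (tables are numbered from `0`): `e` is put into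
the first of them, `j` say, in which the bucket `g j e` has fewer than `c` elements. -/
def throwOne {L k : ℕ} (c s : ℕ) (g : Fin k → Elem L → Bucket L) (S : State L k) (e : Elem L) :
    State L k :=
  match (List.finRange k).find? fun j => decide (s ≤ j.val ∧ (S.tables j (g j e)).length < c) with
  | some j =>
    let T : Table L := Function.update (S.tables j) (g j e) (S.tables j (g j e) ++ [e])
    { tables := Function.update S.tables j T, lost := S.lost }
  | none => { tables := S.tables, lost := S.lost ++ [e] }

/-- Throw the elements of a list one after the other. -/
def throwList {L k : ℕ} (c s : ℕ) (g : Fin k → Elem L → Bucket L) (S : State L k)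
    (es : List (Elem L)) : State L k :=
  es.foldl (throwOne c s g) S

/-- The random choices of the setup. For tables (and phases) `i`, `j` and stages `r`:
* `ω.1 j` is the hash function of the initial throw into table `j`;
* `ω.2.1 i j` is the hash function of the throw of phase `i` into table `j` (used for `i < j`);
* `ω.2.2.1 i` is the hash function `h_i` according to which table `i` is routed;
* `ω.2.2.2 i r` decides which elements are spilled in stage `r` of the routing of table `i`. -/
abbrev Coins (L k : ℕ) : Type :=
  (Fin k → Elem L → Bucket L) × (Fin k → Fin k → Elem L → Bucket L) ×
    (Fin k → Elem L → Bucket L) × (Fin k → Fin L → Equiv.Perm (Elem L))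

/-- Phase `i`: table `i` is routed; the elements that reached their destination stay, and the
spilled ones are thrown into the tables after `i`. (The pretended throws of all other entries of
table `i` leave the tables unchanged. After the last table there is none left, so the elements
spilled there are lost.) -/
def phase {L k : ℕ} (c : ℕ) (ω : Coins L k) (S : State L k) (i : Fin k) : State L k :=
  let N := route c (ω.2.2.1 i) (ω.2.2.2 i) (S.tables i)
  throwList c (i.val + 1) (ω.2.1 i)
    { tables := Function.update S.tables i (routed N), lost := S.lost } (spilled N)

/-- The oblivious insertion of all `2 ^ L` elements into an empty Zigzag hash table. -/
def setup {L k : ℕ} (c : ℕ) (ω : Coins L k) : State L k :=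
  (List.finRange k).foldl (phase c ω)
    (throwList c 0 ω.1 { tables := fun _ _ => [], lost := [] } (List.finRange (2 ^ L)))

/-- The insertion succeeds if every element found a spot. -/
def Succeeds {L k : ℕ} (c : ℕ) (ω : Coins L k) : Prop := (setup c ω).lost = []

instance {L k : ℕ} (c : ℕ) : DecidablePred (Succeeds (L := L) (k := k) c) := fun ω =>
  inferInstanceAs (Decidable ((setup c ω).lost = []))

/-- The probability that the insertion of `n = 2 ^ L` elements into a Zigzag hash table with `k`
tables of `n` buckets of size `c` succeeds: all hash functions and all random choices of the network
are uniform and independent, i.e. the coins are uniform on the finite set of all coins. -/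
noncomputable def successProb (L k c : ℕ) : ℝ :=
  ((Finset.univ.filter fun ω : Coins L k => Succeeds c ω).card : ℝ) / (Fintype.card (Coins L k) : ℝ)

end Zigzag

namespace Zigzag

/-! ### The setup, one table after the other -/

/-! A table is influenced by earlier tables only through the list of elements that arrive at it, so
the insertion can be replayed table by table. Nothing is observed of a finished table except what it
passes on: the elements that found their bucket full, then those spilled by its routing. By
`succeeds_iff`, success means that the list passed on by the last table is empty. Since the coins
split into independent families, one per table, the arrival list is a process driven by fresh coins.

Within one table, let `A` be the set of the `m` arriving elements. An unspilled element occupies,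
before stage `r`, the bucket `hybrid` whose lowest `r` bits come from its destination and whose
other bits come from its arrival bucket. An element that is not stored shares such a bucket, for
some `r ≤ L`, with at least `c` others of `A` (`step_spec`). This condition concerns only hash
values, not the history of the network. For fixed `A` and `r` the hybrid buckets are independent and
uniform, so a given element is crowded with probability at most `m.choose c / n ^ c`. Hence on
average at most `m * (L + 1) * (m / n) ^ c / c!` elements move on (`sum_length_step_le`).

The fraction `m / n` is thus raised to a power above `c` at each table. Markov's inequality against
the doubly exponentially decreasing `threshold`, with the union bound `card_not_good_le`, gives
total failure probability at most `4 * (L + 1) / c!`; once `L < c ^ (k - 1)` the last threshold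
allows fewer than one element. If `k` and `c` are of order `log L`, then `c!` and `c ^ k` exceed
every fixed power of `L`, which settles both conditions. -/

/-- An element together with the throw that brings it to a table: `none` is the initial throw and
`some i` the throw of phase `i`. -/
abbrev Arrival (L k : ℕ) : Type := Option (Fin k) × Elem L

/-- The coins that concern a single table: the hash functions of the throws into it, and the hash
function and the priorities of its routing. -/
abbrev TableCoins (L k : ℕ) : Type :=
  (Elem L → Bucket L) × (Fin k → Elem L → Bucket L) × (Elem L → Bucket L) ×
    (Fin L → Equiv.Perm (Elem L))

/-- The hash function used in a given throw. -/
def throwHash {α β : Type*} (p : α × (β → α)) (a : Option β) : α :=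
  a.elim p.1 p.2

/-- Put an arriving element into a single table if its bucket is not full; otherwise append it to
the list of overflowing elements. -/
def putOne {L k : ℕ} (c : ℕ) (G : Option (Fin k) → Elem L → Bucket L)
    (R : Table L × List (Arrival L k)) (x : Arrival L k) : Table L × List (Arrival L k) :=
  if (R.1 (G x.1 x.2)).length < c then
    (Function.update R.1 (G x.1 x.2) (R.1 (G x.1 x.2) ++ [x.2]), R.2)
  else (R.1, R.2 ++ [x])

/-- Throw a list of arriving elements into a single table. -/
def putList {L k : ℕ} (c : ℕ) (G : Option (Fin k) → Elem L → Bucket L) (T : Table L)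
    (xs : List (Arrival L k)) : Table L × List (Arrival L k) :=
  xs.foldl (putOne c G) (T, [])

/-- The elements that arrive at the table after table `j`, given those that arrive at table `j`. -/
def step {L k : ℕ} (c : ℕ) (j : Fin k) (xs : List (Arrival L k)) (κ : TableCoins L k) :
    List (Arrival L k) :=
  let R := putList c (throwHash (κ.1, κ.2.1)) (fun _ => []) xs
  R.2 ++ (spilled (route c κ.2.2.1 κ.2.2.2 R.1)).map fun e => (some j, e)

/-- The coins of table `j`. -/
def tableCoins {L k : ℕ} (ω : Coins L k) (j : Fin k) : TableCoins L k :=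
  (ω.1 j, fun i => ω.2.1 i j, ω.2.2.1 j, ω.2.2.2 j)

/-- Throw an arriving element into the tables from `s` on. -/
def throwArrival {L k : ℕ} (c s : ℕ) (ω : Coins L k) (S : State L k) (x : Arrival L k) :
    State L k :=
  throwOne c s (throwHash (ω.1, ω.2.1) x.1) S x.2

/-- Replace the content of table `s`. -/
def State.setTable {L k : ℕ} (S : State L k) (s : Fin k) (T : Table L) : State L k :=
  { tables := Function.update S.tables s T, lost := S.lost }

lemma find?_finRange_of_lt {k : ℕ} (s : Fin k) (P : Fin k → Prop) [DecidablePred P] (hP : P s) :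
    (List.finRange k).find? (fun j => decide (s.val ≤ j.val ∧ P j)) = some s := by
  rw [List.find?_eq_some_iff_getElem]
  refine ⟨by simp [hP], s.val, by simp, by simp, fun j hj => ?_⟩
  simp [hj]

lemma find?_finRange_of_not {k : ℕ} (s : Fin k) (P : Fin k → Prop) [DecidablePred P]
    (hP : ¬ P s) :
    (List.finRange k).find? (fun j => decide (s.val ≤ j.val ∧ P j)) =
      (List.finRange k).find? (fun j => decide (s.val + 1 ≤ j.val ∧ P j)) := by
  congr 1
  funext j
  rw [decide_eq_decide]
  constructor
  · rintro ⟨h, hj⟩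
    refine ⟨?_, hj⟩
    rcases h.lt_or_eq with h | h
    · exact h
    · exact absurd (Fin.ext h ▸ hj) hP
  · rintro ⟨h, hj⟩
    exact ⟨by omega, hj⟩

lemma throwOne_of_lt {L k : ℕ} (c : ℕ) (s : Fin k) (g : Fin k → Elem L → Bucket L)
    (S : State L k) (e : Elem L) (h : (S.tables s (g s e)).length < c) :
    throwOne c s g S e =
      S.setTable s (Function.update (S.tables s) (g s e) (S.tables s (g s e) ++ [e])) := by
  unfold throwOne
  rw [find?_finRange_of_lt s (fun j => (S.tables j (g j e)).length < c) h]
  rfl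

lemma throwOne_of_not_lt {L k : ℕ} (c : ℕ) (s : Fin k) (g : Fin k → Elem L → Bucket L)
    (S : State L k) (e : Elem L) (h : ¬ (S.tables s (g s e)).length < c) :
    throwOne c s g S e = throwOne c (s.val + 1) g S e := by
  unfold throwOne
  rw [find?_finRange_of_not s (fun j => (S.tables j (g j e)).length < c) h]

lemma throwOne_tables_of_lt {L k : ℕ} (c s : ℕ) (g : Fin k → Elem L → Bucket L)
    (S : State L k) (e : Elem L) (j : Fin k) (hj : j.val < s) :
    (throwOne c s g S e).tables j = S.tables j := by
  unfold throwOne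
  split
  · rename_i i hi
    have := List.find?_some hi
    simp only [decide_eq_true_eq] at this
    refine Function.update_of_ne ?_ _ _
    rintro rfl
    omega
  · rfl

/-- Throws into tables from `s` on neither read nor write table `j < s`. This commutation is what
permits reordering the insertion by tables. -/
lemma throwOne_setTable {L k : ℕ} (c s : ℕ) (g : Fin k → Elem L → Bucket L)
    (S : State L k) (e : Elem L) (j : Fin k) (hj : j.val < s) (T : Table L) :
    throwOne c s g (S.setTable j T) e = (throwOne c s g S e).setTable j T := by
  have key : ∀ i : Fin k, s ≤ i.val → (S.setTable j T).tables i = S.tables i := by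
    intro i hi
    simp only [State.setTable]
    rw [Function.update_of_ne]
    rintro rfl
    omega
  have hfind : (List.finRange k).find? (fun i => decide (s ≤ i.val ∧
        ((S.setTable j T).tables i (g i e)).length < c)) =
      (List.finRange k).find? (fun i => decide (s ≤ i.val ∧
        (S.tables i (g i e)).length < c)) := by
    congr 1
    funext i
    rw [decide_eq_decide]
    refine and_congr_right fun hi => ?_
    rw [key i hi]
  unfold throwOne
  rw [hfind]
  split
  · rename_i i hi
    have := List.find?_some hi
    simp only [decide_eq_true_eq] at this
    rw [key i this.1]
    simp only [State.setTable]
    rw [Function.update_comm]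
    rintro rfl
    omega
  · rfl

lemma foldl_throwArrival_tables_of_lt {L k : ℕ} (c s : ℕ) (ω : Coins L k)
    (xs : List (Arrival L k)) (S : State L k) (j : Fin k) (hj : j.val < s) :
    (xs.foldl (throwArrival c s ω) S).tables j = S.tables j := by
  induction xs generalizing S with
  | nil => rfl
  | cons x xs ih =>
    rw [List.foldl_cons, ih]
    exact throwOne_tables_of_lt c s _ S x.2 j hj

lemma foldl_throwArrival_setTable {L k : ℕ} (c s : ℕ) (ω : Coins L k)
    (xs : List (Arrival L k)) (S : State L k) (j : Fin k) (hj : j.val < s) (T : Table L) :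
    xs.foldl (throwArrival c s ω) (S.setTable j T) =
      (xs.foldl (throwArrival c s ω) S).setTable j T := by
  induction xs generalizing S with
  | nil => rfl
  | cons x xs ih =>
    rw [List.foldl_cons, List.foldl_cons, ← ih]
    exact congrArg (fun S => xs.foldl (throwArrival c s ω) S)
      (throwOne_setTable c s _ S x.2 j hj T)

lemma State.setTable_setTable {L k : ℕ} (S : State L k) (s : Fin k) (T T' : Table L) :
    (S.setTable s T).setTable s T' = S.setTable s T' := by
  simp [State.setTable]

lemma putList_append_singleton {L k : ℕ} (c : ℕ) (G : Option (Fin k) → Elem L → Bucket L)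
    (T : Table L) (xs : List (Arrival L k)) (x : Arrival L k) :
    putList c G T (xs ++ [x]) = putOne c G (putList c G T xs) x := by
  simp [putList]

lemma throwHash_tableCoins {L k : ℕ} (ω : Coins L k) (s : Fin k) (a : Option (Fin k)) :
    throwHash (ω.1, ω.2.1) a s =
      throwHash ((tableCoins ω s).1, (tableCoins ω s).2.1) a := by
  cases a <;> rfl

/-- Throwing a list into the tables from `s` on amounts to throwing it into table `s`, and the
overflowing elements into the tables after `s`. -/
lemma foldl_throwArrival {L k : ℕ} (c : ℕ) (s : Fin k) (ω : Coins L k)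
    (xs : List (Arrival L k)) (S : State L k) :
    xs.foldl (throwArrival c s ω) S =
      (putList c (throwHash ((tableCoins ω s).1, (tableCoins ω s).2.1)) (S.tables s) xs).2.foldl
        (throwArrival c (s.val + 1) ω)
        (S.setTable s
          (putList c (throwHash ((tableCoins ω s).1, (tableCoins ω s).2.1)) (S.tables s) xs).1) := by
  -- Induction on the last element: it meets table `s` filled by its predecessors, which their
  -- overflow into later tables has not altered.
  induction xs using List.reverseRecOn with
  | nil => simp [putList, State.setTable]
  | append_singleton xs x ih =>
    rw [List.foldl_append, ih, putList_append_singleton]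
    set R := putList c (throwHash ((tableCoins ω s).1, (tableCoins ω s).2.1)) (S.tables s) xs
    have htab : (R.2.foldl (throwArrival c (s.val + 1) ω) (S.setTable s R.1)).tables s = R.1 := by
      rw [foldl_throwArrival_tables_of_lt c _ ω _ _ s (by omega)]
      simp [State.setTable]
    rw [List.foldl_cons, List.foldl_nil]
    generalize hS' : R.2.foldl (throwArrival c (s.val + 1) ω) (S.setTable s R.1) = S' at htab
    unfold putOne
    rw [← throwHash_tableCoins]
    split_ifs with h
    · rw [throwArrival, throwOne_of_lt c s _ _ _ (by rw [htab]; exact h), htab, ← hS']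
      change _ = R.2.foldl (throwArrival c (s.val + 1) ω) _
      rw [← foldl_throwArrival_setTable c _ ω _ _ s (by omega), State.setTable_setTable]
    · rw [throwArrival, throwOne_of_not_lt c s _ _ _ (by rw [htab]; exact h),
        List.foldl_append, hS']
      rfl

lemma foldl_throwArrival_last {L k : ℕ} (c : ℕ) (ω : Coins L k)
    (xs : List (Arrival L k)) (S : State L k) :
    (xs.foldl (throwArrival c k ω) S).lost = S.lost ++ xs.map Prod.snd := by
  induction xs generalizing S with
  | nil => simp
  | cons x xs ih =>
    have h : throwArrival c k ω S x = { tables := S.tables, lost := S.lost ++ [x.2] } := by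
      unfold throwArrival throwOne
      have : (List.finRange k).find? (fun j => decide (k ≤ j.val ∧
          (S.tables j (throwHash (ω.1, ω.2.1) x.1 j x.2)).length < c)) = none := by
        rw [List.find?_eq_none]
        intro j _
        simp only [decide_eq_true_eq]
        omega
      rw [this]
    rw [List.foldl_cons, ih, h]
    simp

/-- The overflow of table `s` went into later tables before the routing, and the routing touches
only table `s`; so the spilled elements simply join the overflow at the end of one list. The final
content `T` is irrelevant, hence only its existence is claimed. -/
lemma phase_foldl {L k : ℕ} (c : ℕ) (s : Fin k) (ω : Coins L k)
    (xs : List (Arrival L k)) (S : State L k) (hS : S.tables s = fun _ => []) :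
    ∃ T : Table L, phase c ω (xs.foldl (throwArrival c s ω) S) s =
      (step c s xs (tableCoins ω s)).foldl (throwArrival c (s.val + 1) ω) (S.setTable s T) := by
  have htab : (xs.foldl (throwArrival c s ω) S).tables s =
      (putList c (throwHash ((tableCoins ω s).1, (tableCoins ω s).2.1)) (fun _ => []) xs).1 := by
    rw [foldl_throwArrival, foldl_throwArrival_tables_of_lt c _ ω _ _ s (by omega), hS]
    simp [State.setTable]
  unfold phase
  rw [htab]
  set R := putList c (throwHash ((tableCoins ω s).1, (tableCoins ω s).2.1)) (fun _ => []) xs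
    with hR
  refine ⟨routed (route c (ω.2.2.1 s) (ω.2.2.2 s) R.1), ?_⟩
  have h1 := foldl_throwArrival c s ω xs S
  rw [hS, ← hR] at h1
  have h2 : ∀ T, (xs.foldl (throwArrival c s ω) S).setTable s T =
      R.2.foldl (throwArrival c (s.val + 1) ω) (S.setTable s T) := by
    intro T
    rw [h1, ← foldl_throwArrival_setTable c _ ω _ _ s (by omega), State.setTable_setTable]
  unfold step
  rw [← hR, List.foldl_append, List.foldl_map, ← h2]
  rfl

/-- Before phase `s` the state is kept in the form "`xs` thrown into empty tables from `s` on";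
`phase_foldl` restores this form for `s + 1`. At `s = k` no table remains and everything thrown is
lost. -/
lemma foldl_phase_lost {L k : ℕ} (c : ℕ) (ω : Coins L k) (d s : ℕ) (hd : s + d = k)
    (xs : List (Arrival L k)) (S : State L k)
    (hS : ∀ j : Fin k, s ≤ j.val → S.tables j = fun _ => []) :
    (((List.finRange k).drop s).foldl (phase c ω) (xs.foldl (throwArrival c s ω) S)).lost =
      S.lost ++ (((List.finRange k).drop s).foldl
        (fun ys j => step c j ys (tableCoins ω j)) xs).map Prod.snd := by
  induction d generalizing s xs S with
  | zero =>
    obtain rfl : s = k := by omega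
    rw [List.drop_of_length_le (by simp)]
    simpa using foldl_throwArrival_last c ω xs S
  | succ d ih =>
    have hs : s < k := by omega
    have hdrop : (List.finRange k).drop s = ⟨s, hs⟩ :: (List.finRange k).drop (s + 1) := by
      rw [List.drop_eq_getElem_cons (by simpa using hs)]
      simp
    rw [hdrop, List.foldl_cons, List.foldl_cons]
    obtain ⟨T, hT⟩ := phase_foldl c ⟨s, hs⟩ ω xs S (hS _ le_rfl)
    rw [hT, ih (s + 1) (by omega)]
    · rfl
    · intro j hj
      simp only [State.setTable]
      rw [Function.update_of_ne, hS j (by omega)]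
      rintro rfl
      simp at hj

/-- All elements, as they arrive at the first table. -/
def initialArrivals (L k : ℕ) : List (Arrival L k) :=
  (List.finRange (2 ^ L)).map fun e => (none, e)

lemma setup_lost {L k : ℕ} (c : ℕ) (ω : Coins L k) :
    (setup c ω).lost = ((List.finRange k).foldl
      (fun ys j => step c j ys (tableCoins ω j)) (initialArrivals L k)).map Prod.snd := by
  have h := foldl_phase_lost c ω k 0 (by omega) (initialArrivals L k)
    { tables := fun _ _ => [], lost := [] } (fun _ _ => rfl)
  rw [List.drop_zero, List.nil_append] at h
  rw [← h]
  unfold setup throwList initialArrivals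
  rw [List.foldl_map]
  rfl

lemma succeeds_iff {L k : ℕ} (c : ℕ) (ω : Coins L k) :
    Succeeds c ω ↔ (List.finRange k).foldl
      (fun ys j => step c j ys (tableCoins ω j)) (initialArrivals L k) = [] := by
  rw [Succeeds, setup_lost, List.map_eq_nil_iff]

/-- The coins, sorted by tables. -/
def coinsEquiv (L k : ℕ) : Coins L k ≃ (Fin k → TableCoins L k) where
  toFun := tableCoins
  invFun κ := (fun j => (κ j).1, fun i j => (κ j).2.1 i, fun j => (κ j).2.2.1,
    fun j => (κ j).2.2.2)
  left_inv _ := rfl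
  right_inv _ := rfl


/-! ### Counting -/

/-- The bucket of an element in the network before stage `r`, while it has not been spilled: the
lowest `r` bits are those of its destination, the others those of its origin. -/
def hybrid {L : ℕ} (h g : Elem L → Bucket L) (r : ℕ) (e : Elem L) : Bucket L :=
  fun i => if i.val < r then h e i else g e i

/-- At least `c` other elements of `A` collide with `e`. -/
def Crowded {α β : Type*} [DecidableEq α] [DecidableEq β] (c : ℕ) (A : Finset α) (f : α → β)
    (e : α) : Prop :=
  c ≤ ((A.erase e).filter fun e' => f e' = f e).card

/-- Flip the bits of all hash values of every element `e` according to `u e`. -/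
def shift {L k : ℕ} (u : Elem L → Bucket L) (κ : TableCoins L k) : TableCoins L k :=
  (fun e i => (κ.1 e i).xor (u e i), fun a e i => (κ.2.1 a e i).xor (u e i),
    fun e i => (κ.2.2.1 e i).xor (u e i), κ.2.2.2)

lemma shift_injective {L k : ℕ} (u : Elem L → Bucket L) :
    Function.Injective (shift (k := k) u) := by
  have : Function.LeftInverse (shift (k := k) u) (shift u) := by
    intro κ
    simp [shift]
  exact this.injective

/-- The hash function that applies to each element when `src e` is the throw that brings `e` to the
table. -/
def arrivalHash {L k : ℕ} (src : Elem L → Option (Fin k)) (κ : TableCoins L k) (e : Elem L) :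
    Bucket L :=
  throwHash (κ.1, κ.2.1) (src e) e

/-- All hash values of `e` are shifted by the same `u e`, so it does not matter which of them
supplies a bit. -/
lemma hybrid_shift {L k : ℕ} (src : Elem L → Option (Fin k)) (u : Elem L → Bucket L)
    (κ : TableCoins L k) (r : ℕ) (e : Elem L) (i : Fin L) :
    hybrid (shift u κ).2.2.1 (arrivalHash src (shift u κ)) r e i =
      (hybrid κ.2.2.1 (arrivalHash src κ) r e i).xor (u e i) := by
  unfold hybrid
  split_ifs with h
  · rfl
  · unfold arrivalHash
    cases src e <;> rfl

/-- Independence and uniformity as an injection: shifting the elements of `S` by arbitrary `u` turns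
one colliding coin into `(2 ^ L) ^ S.card` coins, with no coincidence among the results. -/
lemma card_collide_mul_le {L k : ℕ} (src : Elem L → Option (Fin k)) (r : ℕ) (e : Elem L)
    (S : Finset (Elem L)) (he : e ∉ S) :
    (Finset.univ.filter fun κ : TableCoins L k => ∀ e' ∈ S,
      hybrid κ.2.2.1 (arrivalHash src κ) r e' = hybrid κ.2.2.1 (arrivalHash src κ) r e).card *
        (2 ^ L) ^ S.card ≤ Fintype.card (TableCoins L k) := by
  classical
  have hcard : Fintype.card (S → Bucket L) = (2 ^ L) ^ S.card := by simp
  rw [← hcard, ← Finset.card_univ, ← Finset.card_univ, ← Finset.card_product]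
  let ext : (S → Bucket L) → Elem L → Bucket L := fun u e' =>
    if h : e' ∈ S then u ⟨e', h⟩ else fun _ => false
  refine Finset.card_le_card_of_injOn (fun x => shift (ext x.2) x.1) (fun _ _ => Finset.mem_univ _)
    ?_
  rintro ⟨κ, u⟩ h₁ ⟨κ', u'⟩ h₂ heq
  simp only [Finset.coe_product, Set.mem_prod, Finset.mem_coe, Finset.mem_filter,
    Finset.mem_univ, true_and, and_true] at h₁ h₂
  simp only at heq
  -- `e` lies outside `S` and stays put, so its bucket in the shifted coin is the former common
  -- bucket; comparing with `e'` reveals `u e'`.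
  have hu : u = u' := by
    funext ⟨e', he'⟩ i
    have h3 := hybrid_shift src (ext u) κ r e' i
    have h4 := hybrid_shift src (ext u') κ' r e' i
    have h5 := hybrid_shift src (ext u) κ r e i
    have h6 := hybrid_shift src (ext u') κ' r e i
    rw [heq] at h3 h5
    rw [h3, h₁ e' he', h₂ e' he'] at h4
    rw [h5] at h6
    simp only [ext, he', he, dif_pos, dif_neg, not_false_iff, Bool.xor_false] at h4 h6
    rw [h6] at h4
    exact Bool.xor_right_inj.mp h4
  subst hu
  rw [shift_injective _ heq]

open Classical in
-- A union bound over the `c`-element sets that could form the crowd.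
lemma card_crowded_mul_le {L k : ℕ} (src : Elem L → Option (Fin k)) (r c : ℕ) (e : Elem L)
    (A : Finset (Elem L)) :
    (Finset.univ.filter fun κ : TableCoins L k =>
      Crowded c A (hybrid κ.2.2.1 (arrivalHash src κ) r) e).card * (2 ^ L) ^ c ≤
        A.card.choose c * Fintype.card (TableCoins L k) := by
  let P : Finset (Elem L) → Finset (TableCoins L k) := fun S =>
    Finset.univ.filter fun κ : TableCoins L k => ∀ e' ∈ S,
      hybrid κ.2.2.1 (arrivalHash src κ) r e' = hybrid κ.2.2.1 (arrivalHash src κ) r e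
  have hsub : (Finset.univ.filter fun κ : TableCoins L k =>
      Crowded c A (hybrid κ.2.2.1 (arrivalHash src κ) r) e) ⊆
        ((A.erase e).powersetCard c).biUnion P := by
    intro κ hκ
    obtain ⟨S, hS, hc⟩ := Finset.exists_subset_card_eq (Finset.mem_filter.mp hκ).2
    refine Finset.mem_biUnion.mpr ⟨S, ?_, ?_⟩
    · exact Finset.mem_powersetCard.mpr ⟨hS.trans (Finset.filter_subset _ _), hc⟩
    · exact Finset.mem_filter.mpr
        ⟨Finset.mem_univ _, fun e' he' => (Finset.mem_filter.mp (hS he')).2⟩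
  calc _ ≤ (((A.erase e).powersetCard c).biUnion P).card * (2 ^ L) ^ c :=
        Nat.mul_le_mul_right _ (Finset.card_le_card hsub)
    _ ≤ (∑ S ∈ (A.erase e).powersetCard c, (P S).card) * (2 ^ L) ^ c :=
        Nat.mul_le_mul_right _ Finset.card_biUnion_le
    _ = ∑ S ∈ (A.erase e).powersetCard c, (P S).card * (2 ^ L) ^ c := Finset.sum_mul _ _ _
    _ ≤ ∑ _S ∈ (A.erase e).powersetCard c, Fintype.card (TableCoins L k) := by
        refine Finset.sum_le_sum fun S hS => ?_
        obtain ⟨hS, hc⟩ := Finset.mem_powersetCard.mp hS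
        rw [← hc]
        exact card_collide_mul_le src r e S fun h => by simpa using hS h
    _ = (A.erase e).card.choose c * Fintype.card (TableCoins L k) := by
        rw [Finset.sum_const, Finset.card_powersetCard, smul_eq_mul]
    _ ≤ _ := Nat.mul_le_mul_right _
        (Nat.choose_le_choose c (Finset.card_le_card (Finset.erase_subset _ _)))

open Classical in
lemma sum_card_crowded_le {L k : ℕ} (src : Elem L → Option (Fin k)) (c : ℕ)
    (A : Finset (Elem L)) :
    ∑ κ : TableCoins L k, ((A.filter fun e => ∃ r ∈ Finset.range (L + 1),
        Crowded c A (hybrid κ.2.2.1 (arrivalHash src κ) r) e).card : ℝ) ≤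
      A.card * (L + 1) * ((A.card : ℝ) / 2 ^ L) ^ c / c.factorial *
        Fintype.card (TableCoins L k) := by
  have h1 : ∀ κ : TableCoins L k, ((A.filter fun e => ∃ r ∈ Finset.range (L + 1),
        Crowded c A (hybrid κ.2.2.1 (arrivalHash src κ) r) e).card : ℝ) ≤
      ∑ e ∈ A, ∑ r ∈ Finset.range (L + 1),
        if Crowded c A (hybrid κ.2.2.1 (arrivalHash src κ) r) e then (1 : ℝ) else 0 := by
    intro κ
    rw [Finset.card_filter, Nat.cast_sum]
    refine Finset.sum_le_sum fun e _ => ?_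
    have hnn : ∀ r ∈ Finset.range (L + 1), (0 : ℝ) ≤
        if Crowded c A (hybrid κ.2.2.1 (arrivalHash src κ) r) e then (1 : ℝ) else 0 := by
      intro r _
      split_ifs <;> norm_num
    split_ifs with h
    · obtain ⟨r, hr, h⟩ := h
      refine le_trans ?_ (Finset.single_le_sum hnn hr)
      rw [if_pos h, Nat.cast_one]
    · rw [Nat.cast_zero]
      exact Finset.sum_nonneg hnn
  have h2 : ∀ e r, ∑ κ : TableCoins L k,
      (if Crowded c A (hybrid κ.2.2.1 (arrivalHash src κ) r) e then (1 : ℝ) else 0) ≤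
        ((A.card : ℝ) / 2 ^ L) ^ c / c.factorial * Fintype.card (TableCoins L k) := by
    intro e r
    rw [Finset.sum_boole]
    have h3 := card_crowded_mul_le (k := k) src r c e A
    have h4 := Nat.choose_le_pow_div (α := ℝ) c A.card
    have h5 : ((Finset.univ.filter fun κ : TableCoins L k =>
      Crowded c A (hybrid κ.2.2.1 (arrivalHash src κ) r) e).card : ℝ) * (2 ^ L) ^ c ≤
        A.card.choose c * Fintype.card (TableCoins L k) := by exact_mod_cast h3
    rw [div_pow, div_div, mul_comm (_ ^ c), ← div_div, div_mul_eq_mul_div,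
      le_div_iff₀ (by positivity)]
    exact h5.trans (mul_le_mul_of_nonneg_right h4 (by positivity))
  calc _ ≤ ∑ κ : TableCoins L k, ∑ e ∈ A, ∑ r ∈ Finset.range (L + 1),
        (if Crowded c A (hybrid κ.2.2.1 (arrivalHash src κ) r) e then (1 : ℝ) else 0) :=
        Finset.sum_le_sum fun κ _ => h1 κ
    _ = ∑ e ∈ A, ∑ r ∈ Finset.range (L + 1), ∑ κ : TableCoins L k,
        (if Crowded c A (hybrid κ.2.2.1 (arrivalHash src κ) r) e then (1 : ℝ) else 0) := by
        rw [Finset.sum_comm]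
        exact Finset.sum_congr rfl fun _ _ => Finset.sum_comm
    _ ≤ ∑ e ∈ A, ∑ r ∈ Finset.range (L + 1),
        ((A.card : ℝ) / 2 ^ L) ^ c / c.factorial * Fintype.card (TableCoins L k) :=
        Finset.sum_le_sum fun e _ => Finset.sum_le_sum fun r _ => h2 e r
    _ = _ := by
        rw [Finset.sum_const, Finset.sum_const, Finset.card_range, nsmul_eq_mul, nsmul_eq_mul,
          Nat.cast_add, Nat.cast_one]
        ring

/-- A union bound for a process driven by independent uniform coins: if in each step the process
leaves the good states with probability at most `p j`, then it is in a bad state at the end with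
probability at most the sum of the `p j`. -/
lemma card_not_good_le {σ C : Type*} [Fintype C] (k : ℕ) (f : Fin k → σ → C → σ)
    (Good : ℕ → σ → Prop) (p : ℕ → ℝ) (hp : ∀ j, 0 ≤ p j) (x : σ) (hx : Good 0 x)
    (hstep : ∀ (j : Fin k) y, Good j y →
      (Nat.card {κ : C // ¬ Good (j + 1) (f j y κ)} : ℝ) ≤ p j * Fintype.card C) :
    (Nat.card {ω : Fin k → C //
      ¬ Good k ((List.finRange k).foldl (fun y j => f j y (ω j)) x)} : ℝ) ≤
        (∑ j ∈ Finset.range k, p j) * (Fintype.card C : ℝ) ^ k := by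
  classical
  induction k generalizing Good p x with
  | zero => simp [hx]
  | succ k ih =>
    have hfold : ∀ (κ : C) (ω : Fin k → C),
        (List.finRange (k + 1)).foldl (fun y j => f j y ((Fin.cons κ ω : Fin (k + 1) → C) j)) x =
          (List.finRange k).foldl (fun y j => f j.succ y (ω j)) (f 0 x κ) := by
      intro κ ω
      rw [List.finRange_succ, List.foldl_cons, List.foldl_map]
      simp
    have hcard : Nat.card {ω : Fin (k + 1) → C //
        ¬ Good (k + 1) ((List.finRange (k + 1)).foldl (fun y j => f j y (ω j)) x)} =
        ∑ κ : C, Nat.card {ω : Fin k → C // ¬ Good (k + 1)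
          ((List.finRange k).foldl (fun y j => f j.succ y (ω j)) (f 0 x κ))} := by
      rw [← Nat.card_sigma]
      refine Nat.card_congr (Equiv.symm ?_)
      refine (Equiv.subtypeProdEquivSigmaSubtype fun (κ : C) (ω : Fin k → C) =>
        ¬ Good (k + 1) ((List.finRange k).foldl (fun y j => f j.succ y (ω j))
          (f 0 x κ))).symm.trans ?_
      refine (Fin.consEquiv fun _ => C).subtypeEquiv fun y => ?_
      rw [← hfold]
      rfl
    -- `Q` pays for the steps after the first; a bad first coin is charged the trivial bound `1`.
    set Q := ∑ j ∈ Finset.range k, p (j + 1)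
    have hQ : ∀ κ : C, (Nat.card {ω : Fin k → C // ¬ Good (k + 1)
          ((List.finRange k).foldl (fun y j => f j.succ y (ω j)) (f 0 x κ))} : ℝ) ≤
        (Q + if ¬ Good 1 (f 0 x κ) then 1 else 0) * (Fintype.card C : ℝ) ^ k := by
      intro κ
      by_cases h : Good 1 (f 0 x κ)
      · rw [if_neg (not_not.mpr h), add_zero]
        exact ih (fun j => f j.succ) (fun j => Good (j + 1)) (fun j => p (j + 1))
          (fun j => hp (j + 1)) _ h
          fun j y hy => by simpa using hstep j.succ y (by simpa using hy)
      · rw [if_pos h]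
        have hle : (Nat.card {ω : Fin k → C // ¬ Good (k + 1)
            ((List.finRange k).foldl (fun y j => f j.succ y (ω j)) (f 0 x κ))} : ℝ) ≤
              (Fintype.card C : ℝ) ^ k := by
          rw [Nat.card_eq_fintype_card]
          have := Fintype.card_subtype_le fun ω : Fin k → C => ¬ Good (k + 1)
            ((List.finRange k).foldl (fun y j => f j.succ y (ω j)) (f 0 x κ))
          rw [Fintype.card_fun, Fintype.card_fin] at this
          exact_mod_cast this
        have hQ0 : 0 ≤ Q := Finset.sum_nonneg fun j _ => hp (j + 1)
        exact hle.trans (le_mul_of_one_le_left (by positivity) (by linarith))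
    rw [hcard, Nat.cast_sum]
    refine (Finset.sum_le_sum fun κ _ => hQ κ).trans ?_
    have h0 := hstep 0 x hx
    rw [← Finset.sum_mul, Finset.sum_add_distrib, Finset.sum_boole, Finset.sum_const,
      Finset.sum_range_succ', pow_succ']
    rw [Nat.card_eq_fintype_card, Fintype.card_subtype] at h0
    simp only [nsmul_eq_mul, Finset.card_univ]
    rw [← mul_assoc]
    refine mul_le_mul_of_nonneg_right ?_ (by positivity)
    rw [add_mul]
    refine add_le_add (mul_comm _ _).le ?_
    simpa using h0


/-! ### Elements that are not stored in a table collide with many others -/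

lemma crowded_of_list {α β : Type*} [DecidableEq α] [DecidableEq β] {c : ℕ} {A : Finset α}
    {f : α → β} {e : α} (l : List α) (hl : l.Nodup) (hc : c ≤ l.length)
    (h : ∀ e' ∈ l, e' ∈ A ∧ e' ≠ e ∧ f e' = f e) : Crowded c A f e := by
  unfold Crowded
  rw [← List.toFinset_card_of_nodup hl] at hc
  refine hc.trans (Finset.card_le_card fun e' he' => ?_)
  obtain ⟨h1, h2, h3⟩ := h e' (List.mem_toFinset.mp he')
  simp [h1, h2, h3]

lemma Crowded.mono {α β : Type*} [DecidableEq α] [DecidableEq β] {c : ℕ} {A B : Finset α}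
    {f : α → β} {e : α} (h : Crowded c A f e) (hAB : A ⊆ B) : Crowded c B f e :=
  h.trans (Finset.card_le_card (Finset.filter_subset_filter _ (Finset.erase_subset_erase _ hAB)))

/-- What throwing a list of distinct elements into an empty table results in. -/
lemma putList_spec {L k : ℕ} (c : ℕ) (G : Option (Fin k) → Elem L → Bucket L)
    (g : Elem L → Bucket L) (xs : List (Arrival L k)) (hnd : (xs.map Prod.snd).Nodup)
    (hg : ∀ x ∈ xs, G x.1 x.2 = g x.2) :
    (putList c G (fun _ => []) xs).2.Sublist xs ∧
    (∀ b, ((putList c G (fun _ => []) xs).1 b).Nodup) ∧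
    (∀ b, ∀ e ∈ (putList c G (fun _ => []) xs).1 b, e ∈ xs.map Prod.snd ∧ g e = b ∧
      e ∉ (putList c G (fun _ => []) xs).2.map Prod.snd) ∧
    ∀ x ∈ (putList c G (fun _ => []) xs).2, Crowded c (xs.map Prod.snd).toFinset g x.2 := by
  induction xs using List.reverseRecOn with
  | nil => simp [putList]
  | append_singleton xs x ih =>
    rw [putList_append_singleton]
    rw [List.map_append, List.nodup_append] at hnd
    obtain ⟨hnd, -, hx⟩ := hnd
    have hx' : x.2 ∉ xs.map Prod.snd := fun h => hx _ h x.2 (by simp) rfl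
    obtain ⟨h1, h2, h3, h4⟩ := ih hnd fun y hy => hg y (by simp [hy])
    have hgx := hg x (by simp)
    set R := putList c G (fun _ => []) xs
    have h4' : ∀ y ∈ R.2, Crowded c ((xs ++ [x]).map Prod.snd).toFinset g y.2 := by
      refine fun y hy => (h4 y hy).mono fun e he => ?_
      rw [List.mem_toFinset] at he ⊢
      rw [List.map_append]
      exact List.mem_append_left _ he
    have hxR : x.2 ∉ R.2.map Prod.snd := fun h => hx' ((h1.map _).subset h)
    unfold putOne
    split_ifs with h
    · refine ⟨h1.trans (List.sublist_append_left _ _), fun b => ?_, fun b e he => ?_, h4'⟩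
      · rcases eq_or_ne b (G x.1 x.2) with rfl | hb
        · simp only [Function.update_self]
          refine List.nodup_append.mpr ⟨h2 _, by simp, ?_⟩
          rintro e he e' he' rfl
          rw [List.mem_singleton] at he'
          exact hx' (he' ▸ (h3 _ _ he).1)
        · simpa [Function.update_of_ne hb] using h2 b
      · rcases eq_or_ne b (G x.1 x.2) with rfl | hb
        · simp only [Function.update_self, List.mem_append, List.mem_singleton] at he
          rcases he with he | rfl
          · exact ⟨by simpa using Or.inl (by simpa using (h3 _ _ he).1), (h3 _ _ he).2⟩
          · exact ⟨by simp, hgx.symm, hxR⟩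
        · simp only [Function.update_of_ne hb] at he
          exact ⟨by simpa using Or.inl (by simpa using (h3 _ _ he).1), (h3 _ _ he).2⟩
    · refine ⟨h1.append (List.Sublist.refl _), h2, fun b e he => ?_, fun y hy => ?_⟩
      · refine ⟨by simpa using Or.inl (by simpa using (h3 _ _ he).1), (h3 _ _ he).2.1, ?_⟩
        rw [List.map_append, List.mem_append, not_or]
        refine ⟨(h3 _ _ he).2.2, fun h' => hx' ?_⟩
        rw [List.map_singleton, List.mem_singleton] at h'
        exact h' ▸ (h3 _ _ he).1
      · rw [List.mem_append, List.mem_singleton] at hy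
        rcases hy with hy | rfl
        · exact h4' y hy
        -- The crowd is the content of the full bucket that rejected `y`.
        · refine crowded_of_list (R.1 (G y.1 y.2)) (h2 _) (not_lt.mp h) fun e he => ?_
          obtain ⟨h5, h6, -⟩ := h3 _ _ he
          refine ⟨?_, ?_, h6.trans hgx⟩
          · rw [List.mem_toFinset, List.map_append]
            exact List.mem_append_left _ h5
          · rintro rfl
            exact hx' h5

lemma mem_choose {L c : ℕ} {prio : Equiv.Perm (Elem L)} {xs : List (Elem L)} {e : Elem L} :
    e ∈ choose c prio xs ↔
      e ∈ xs ∧ (xs.filter fun e' => decide (prio e' < prio e)).length < c := by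
  simp [choose]

/-- The content of two paired buckets after their re-partition. -/
lemma repartition_spec {L : ℕ} (c : ℕ) (h : Elem L → Bucket L) (prio : Equiv.Perm (Elem L))
    (i : Fin L) (pool : List (Elem L × Bool)) (hnd : (pool.map Prod.fst).Nodup) :
    (((repartition c h prio i pool).1 ++ (repartition c h prio i pool).2).map Prod.fst).Nodup ∧
    (∀ v : Bool, ∀ x ∈ if v then (repartition c h prio i pool).2
        else (repartition c h prio i pool).1,
      (x.2 = true → x ∈ pool ∧ h x.1 i = v) ∧
      (x.2 = false → x ∈ pool ∨ (x.1, true) ∈ pool ∧ ∃ l : List (Elem L), l.Nodup ∧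
        c ≤ l.length ∧ ∀ e ∈ l, (e, true) ∈ pool ∧ e ≠ x.1 ∧ h e i = h x.1 i)) := by
  set cand : Bool → List (Elem L) := fun v =>
    (pool.filter fun x => x.2 && (h x.1 i == v)).map Prod.fst with hcand
  set kept : Bool → List (Elem L) := fun v => choose c prio (cand v) with hkept
  set deadp := pool.filter fun x => !(x.2 && decide (x.1 ∈ kept (h x.1 i))) with hdeadp
  set dead : List (Elem L) := deadp.map Prod.fst with hdead
  have hrep : repartition c h prio i pool =
      ((kept false).map (fun e => (e, true)) ++
          (dead.take (c - (kept false).length)).map (fun e => (e, false)),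
        (dead.drop (c - (kept false).length)).map (fun e => (e, false)) ++
          (kept true).map (fun e => (e, true))) := rfl
  have hcnd : ∀ v, (cand v).Nodup := fun v => hnd.sublist (List.filter_sublist.map _)
  have hknd : ∀ v, (kept v).Nodup := fun v => (hcnd v).sublist List.filter_sublist
  have hdnd : dead.Nodup := hnd.sublist (List.filter_sublist.map _)
  have hcmem : ∀ v e, e ∈ cand v ↔ (e, true) ∈ pool ∧ h e i = v := by
    intro v e
    simp [hcand]
  have hkmem : ∀ v, ∀ e ∈ kept v, (e, true) ∈ pool ∧ h e i = v := fun v e he =>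
    (hcmem v e).mp (mem_choose.mp he).1
  have hinj : ∀ x ∈ pool, ∀ y ∈ pool, x.1 = y.1 → x = y := fun x hx y hy hxy =>
    List.inj_on_of_nodup_map hnd hx hy hxy
  have hdk : ∀ v, ∀ e ∈ kept v, e ∉ dead := by
    intro v e he hed
    obtain ⟨x, hx, rfl⟩ := List.mem_map.mp hed
    obtain ⟨hx1, hx2⟩ := List.mem_filter.mp hx
    obtain ⟨h1, h2⟩ := hkmem v _ he
    have h3 := hinj _ hx1 _ h1 rfl
    have h4 : x.2 = true := by rw [h3]
    rw [h4, h2] at hx2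
    simp [he] at hx2
  have hkk : ∀ e ∈ kept false, e ∉ kept true := by
    intro e h1 h2
    have h3 := (hkmem _ _ h1).2
    rw [(hkmem _ _ h2).2] at h3
    cases h3
  have hdmem : ∀ e ∈ dead, (e, false) ∈ pool ∨ (e, true) ∈ pool ∧ ∃ l : List (Elem L), l.Nodup ∧
      c ≤ l.length ∧ ∀ e' ∈ l, (e', true) ∈ pool ∧ e' ≠ e ∧ h e' i = h e i := by
    intro e he
    obtain ⟨⟨e, t⟩, hx, rfl⟩ := List.mem_map.mp he
    obtain ⟨hx1, hx2⟩ := List.mem_filter.mp hx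
    cases t with
    | false => exact Or.inl hx1
    | true =>
      -- The crowd consists of the candidates preferred to `e`; fewer than `c` of them would mean
      -- that `e` is kept.
      refine Or.inr ⟨hx1, (cand (h e i)).filter fun e' => decide (prio e' < prio e),
        (hcnd _).sublist List.filter_sublist, ?_, fun e' he' => ?_⟩
      · by_contra hlt
        have : e ∈ kept (h e i) := mem_choose.mpr ⟨(hcmem _ _).mpr ⟨hx1, rfl⟩, not_le.mp hlt⟩
        simp [this] at hx2
      · obtain ⟨h1, h2⟩ := List.mem_filter.mp he'
        refine ⟨((hcmem _ _).mp h1).1, ?_, ((hcmem _ _).mp h1).2⟩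
        rintro rfl
        simp at h2
  rw [hrep]
  set m := c - (kept false).length
  refine ⟨?_, ?_⟩
  · have hperm : (kept false ++ dead.take m ++ (dead.drop m ++ kept true)) =
        kept false ++ (dead ++ kept true) := by
      rw [List.append_assoc, ← List.append_assoc (dead.take m), List.take_append_drop]
    have hmap : ∀ (l : List (Elem L)) (t : Bool), (l.map fun e => (e, t)).map Prod.fst = l := by
      intro l t
      simp [Function.comp_def]
    simp only [List.map_append, hmap]
    rw [hperm, List.nodup_append', List.nodup_append']
    refine ⟨hknd _, ⟨hdnd, hknd _, fun e h1 h2 => hdk _ _ h2 h1⟩, fun e h1 h2 => ?_⟩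
    rcases List.mem_append.mp h2 with h2 | h2
    · exact hdk _ _ h1 h2
    · exact hkk _ h1 h2
  · have hd : ∀ e ∈ dead, ∀ v, (((e, false) : Elem L × Bool).2 = true →
          (e, false) ∈ pool ∧ h e i = v) ∧
        (((e, false) : Elem L × Bool).2 = false → (e, false) ∈ pool ∨ (e, true) ∈ pool ∧
          ∃ l : List (Elem L), l.Nodup ∧
          c ≤ l.length ∧ ∀ e' ∈ l, (e', true) ∈ pool ∧ e' ≠ e ∧ h e' i = h e i) :=
      fun e he v => ⟨fun h => by simp at h, fun _ => hdmem e he⟩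
    rintro (_ | _) x hx
    · simp only [Bool.false_eq_true, if_false, List.mem_append, List.mem_map] at hx
      rcases hx with ⟨e, he, rfl⟩ | ⟨e, he, rfl⟩
      · exact ⟨fun _ => hkmem _ _ he, fun h => by simp at h⟩
      · exact hd e (List.mem_of_mem_take he) _
    · simp only [if_true, List.mem_append, List.mem_map] at hx
      rcases hx with ⟨e, he, rfl⟩ | ⟨e, he, rfl⟩
      · exact hd e (List.mem_of_mem_drop he) _
      · exact ⟨fun _ => hkmem _ _ he, fun h => by simp at h⟩


/-! ### The invariant of the routing network -/

lemma foldl_finRange_induction {α : Type*} (n : ℕ) (f : α → Fin n → α) (P : ℕ → α → Prop) (x : α)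
    (h0 : P 0 x) (hf : ∀ (i : Fin n) y, P i y → P (i + 1) (f y i)) :
    P n ((List.finRange n).foldl f x) := by
  induction n generalizing P x with
  | zero => simpa using h0
  | succ n ih =>
    rw [List.finRange_succ, List.foldl_cons, List.foldl_map]
    exact ih (fun y i => f y i.succ) (fun r => P (r + 1)) (f x 0) (by simpa using hf 0 x h0)
      fun i y hy => by simpa using hf i.succ y (by simpa using hy)

/-- What is known about the network before stage `r`, if the elements of the table are those of `A`
and `g` gives their buckets. -/
structure NetworkInvariant {L : ℕ} (c : ℕ) (h g : Elem L → Bucket L) (A : Finset (Elem L)) (r : ℕ)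
    (N : Network L) : Prop where
  nodup : ∀ b, ((N b).map Prod.fst).Nodup
  disjoint : ∀ b b' e, e ∈ (N b).map Prod.fst → e ∈ (N b').map Prod.fst → b = b'
  mem : ∀ b, ∀ x ∈ N b, x.1 ∈ A
  hybrid_eq : ∀ b, ∀ x ∈ N b, x.2 = true → hybrid h g r x.1 = b
  crowded : ∀ b, ∀ x ∈ N b, x.2 = false →
    ∃ r' ∈ Finset.range (L + 1), Crowded c A (hybrid h g r') x.1

lemma hybrid_succ {L : ℕ} (h g : Elem L → Bucket L) (i : Fin L) (e : Elem L) :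
    hybrid h g (i + 1) e = Function.update (hybrid h g i e) i (h e i) := by
  funext j
  rcases eq_or_ne j i with rfl | hj
  · simp [hybrid]
  · rw [Function.update_of_ne hj]
    have : j.val ≠ i.val := fun h => hj (Fin.ext h)
    unfold hybrid
    congr 1
    rw [eq_iff_iff]
    omega

/-- Unspilled elements of a pair of buckets have hybrid buckets agreeing outside bit `i`, and the
stage overwrites that bit by the destination's. Those competing for the same side therefore have
equal hybrids at `i + 1`, whether kept or spilled. -/
lemma NetworkInvariant.stage {L : ℕ} {c : ℕ} {h g : Elem L → Bucket L} {A : Finset (Elem L)}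
    {i : Fin L} {N : Network L} (prio : Equiv.Perm (Elem L))
    (hN : NetworkInvariant c h g A i N) :
    NetworkInvariant c h g A (i + 1) (stage c h prio N i) := by
  set pool : Bucket L → List (Elem L × Bool) := fun b =>
    N (Function.update b i false) ++ N (Function.update b i true) with hpool
  have hstage : ∀ b, Zigzag.stage c h prio N i b =
      if b i then (repartition c h prio i (pool b)).2
        else (repartition c h prio i (pool b)).1 := fun _ => rfl
  have hmem : ∀ b x, x ∈ pool b → ∃ v, x ∈ N (Function.update b i v) := by
    intro b x hx
    rcases List.mem_append.mp hx with hx | hx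
    · exact ⟨_, hx⟩
    · exact ⟨_, hx⟩
  have hpnd : ∀ b, ((pool b).map Prod.fst).Nodup := by
    intro b
    rw [hpool, List.map_append, List.nodup_append']
    refine ⟨hN.nodup _, hN.nodup _, fun e h1 h2 => ?_⟩
    have := congrFun (hN.disjoint _ _ e h1 h2) i
    simp at this
  have hspec := fun b => repartition_spec c h prio i (pool b) (hpnd b)
  have hspec2 : ∀ b, ∀ x ∈ Zigzag.stage c h prio N i b,
      (x.2 = true → x ∈ pool b ∧ h x.1 i = b i) ∧
      (x.2 = false → x ∈ pool b ∨ (x.1, true) ∈ pool b ∧ ∃ l : List (Elem L), l.Nodup ∧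
        c ≤ l.length ∧ ∀ e ∈ l, (e, true) ∈ pool b ∧ e ≠ x.1 ∧ h e i = h x.1 i) := by
    intro b x hx
    rw [hstage] at hx
    exact (hspec b).2 (b i) x hx
  have hspec3 : ∀ b, ∀ x ∈ Zigzag.stage c h prio N i b, ∃ t, (x.1, t) ∈ pool b := by
    intro b x hx
    obtain ⟨h1, h2⟩ := hspec2 b x hx
    obtain ⟨e, _ | _⟩ := x
    · rcases h2 rfl with h2 | h2
      · exact ⟨_, h2⟩
      · exact ⟨_, h2.1⟩
    · exact ⟨_, (h1 rfl).1⟩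
  have hhyb : ∀ b e, (e, true) ∈ pool b →
      hybrid h g (i + 1) e = Function.update b i (h e i) := by
    intro b e he
    obtain ⟨v, hv⟩ := hmem b _ he
    rw [hybrid_succ, hN.hybrid_eq _ _ hv rfl, Function.update_idem]
  refine ⟨fun b => ?_, fun b b' e hb hb' => ?_, fun b x hx => ?_, fun b x hx ht => ?_,
    fun b x hx ht => ?_⟩
  · have := (hspec b).1
    rw [List.map_append, List.nodup_append'] at this
    rw [hstage]
    split_ifs
    · exact this.2.1
    · exact this.1
  · obtain ⟨x, hx, rfl⟩ := List.mem_map.mp hb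
    obtain ⟨x', hx', hxx⟩ := List.mem_map.mp hb'
    obtain ⟨t, ht⟩ := hspec3 b x hx
    obtain ⟨t', ht'⟩ := hspec3 b' x' hx'
    obtain ⟨v, hv⟩ := hmem b _ ht
    obtain ⟨v', hv'⟩ := hmem b' _ ht'
    have hbb : Function.update b i v = Function.update b' i v' :=
      hN.disjoint _ _ x.1 (List.mem_map.mpr ⟨_, hv, rfl⟩) (List.mem_map.mpr ⟨_, hv', hxx⟩)
    have hw : ∀ w, Function.update b i w = Function.update b' i w := by
      intro w
      have := congrArg (fun a => Function.update a i w) hbb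
      simpa using this
    -- `b` and `b'` belong to one pair, so they are equal or the two disjoint outputs of the same
    -- re-partition.
    by_cases hi : b i = b' i
    · have := hw (b i)
      rwa [Function.update_eq_self, hi, Function.update_eq_self] at this
    · exfalso
      have hpp : pool b' = pool b := by
        simp only [hpool, hw]
      have hnd := (hspec b).1
      rw [List.map_append, List.nodup_append'] at hnd
      rw [hstage] at hb hb'
      rw [hpp] at hb'
      cases h1 : b i <;> cases h2 : b' i <;> simp only [h1, h2, if_true, if_false,
        Bool.false_eq_true] at hb hb' hi
      · exact hi trivial
      · exact hnd.2.2 hb hb'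
      · exact hnd.2.2 hb' hb
      · exact hi trivial
  · obtain ⟨t, ht⟩ := hspec3 b x hx
    obtain ⟨v, hv⟩ := hmem b _ ht
    exact hN.mem _ (x.1, t) hv
  · obtain ⟨h1, h2⟩ := (hspec2 b x hx).1 ht
    obtain ⟨e, t⟩ := x
    obtain rfl : t = true := ht
    rw [hhyb b e h1, h2, Function.update_eq_self]
  · obtain ⟨e, t⟩ := x
    obtain rfl : t = false := ht
    rcases (hspec2 b _ hx).2 rfl with h1 | ⟨h1, l, hl, hc, hlmem⟩
    · obtain ⟨v, hv⟩ := hmem b _ h1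
      exact hN.crowded _ _ hv rfl
    · refine ⟨i + 1, by simp, crowded_of_list l hl hc fun e' he' => ?_⟩
      obtain ⟨h2, h3, h4⟩ := hlmem e' he'
      obtain ⟨v, hv⟩ := hmem b _ h2
      exact ⟨hN.mem _ _ hv, h3, by rw [hhyb b e' h2, hhyb b e h1, h4]⟩

lemma networkInvariant_route {L : ℕ} (c : ℕ) (h g : Elem L → Bucket L) (A : Finset (Elem L))
    (prio : Fin L → Equiv.Perm (Elem L)) (T : Table L) (hnd : ∀ b, (T b).Nodup)
    (hT : ∀ b, ∀ e ∈ T b, e ∈ A ∧ g e = b) :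
    NetworkInvariant c h g A L (route c h prio T) := by
  refine foldl_finRange_induction L (fun N i => stage c h (prio i) N i)
    (NetworkInvariant c h g A) _ ?_ fun i N hN => hN.stage (prio i)
  refine ⟨fun b => ?_, fun b b' e hb hb' => ?_, fun b x hx => ?_, fun b x hx _ => ?_,
    fun b x hx ht => ?_⟩
  · simpa [Function.comp_def] using hnd b
  · have h1 : e ∈ T b := by simpa [Function.comp_def] using hb
    have h2 : e ∈ T b' := by simpa [Function.comp_def] using hb'
    rw [← (hT b e h1).2, (hT b' e h2).2]
  · obtain ⟨e, he, rfl⟩ := List.mem_map.mp hx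
    exact (hT b e he).1
  · obtain ⟨e, he, rfl⟩ := List.mem_map.mp hx
    rw [← (hT b e he).2]
    funext j
    simp [hybrid]
  · obtain ⟨e, he, rfl⟩ := List.mem_map.mp hx
    simp at ht

lemma nodup_allBuckets (L : ℕ) : (allBuckets L).Nodup := by
  refine (List.nodup_finRange _).map fun x y hxy => Fin.ext (Nat.eq_of_testBit_eq fun i => ?_)
  by_cases hi : i < L
  · exact congrFun hxy ⟨i, hi⟩
  · have hle : 2 ^ L ≤ 2 ^ i := Nat.pow_le_pow_right (by norm_num) (not_lt.mp hi)
    rw [Nat.testBit_lt_two_pow (x.isLt.trans_le hle), Nat.testBit_lt_two_pow (y.isLt.trans_le hle)]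

lemma NetworkInvariant.nodup_spilled {L : ℕ} {c : ℕ} {h g : Elem L → Bucket L}
    {A : Finset (Elem L)} {r : ℕ} {N : Network L} (hN : NetworkInvariant c h g A r N) :
    (spilled N).Nodup := by
  refine List.nodup_flatMap.mpr ⟨fun b _ => (hN.nodup b).sublist (List.filter_sublist.map _),
    (nodup_allBuckets L).imp fun {b b'} hb e he he' => ?_⟩
  exact hb (hN.disjoint b b' e ((List.filter_sublist.map _).subset he)
    ((List.filter_sublist.map _).subset he'))

lemma NetworkInvariant.crowded_of_mem_spilled {L : ℕ} {c : ℕ} {h g : Elem L → Bucket L}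
    {A : Finset (Elem L)} {r : ℕ} {N : Network L} (hN : NetworkInvariant c h g A r N) {e : Elem L}
    (he : e ∈ spilled N) :
    e ∈ A ∧ ∃ r' ∈ Finset.range (L + 1), Crowded c A (hybrid h g r') e := by
  obtain ⟨b, -, he⟩ := List.mem_flatMap.mp he
  obtain ⟨x, hx, rfl⟩ := List.mem_map.mp he
  obtain ⟨hx, ht⟩ := List.mem_filter.mp hx
  exact ⟨hN.mem b x hx, hN.crowded b x hx (by simpa using ht)⟩

/-- The elements that arrive at the next table are distinct, and each of them collides with `c`
others before some stage of the routing. -/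
lemma step_spec {L k : ℕ} (c : ℕ) (j : Fin k) (xs : List (Arrival L k)) (κ : TableCoins L k)
    (hnd : (xs.map Prod.snd).Nodup) (src : Elem L → Option (Fin k))
    (hsrc : ∀ x ∈ xs, src x.2 = x.1) :
    ((step c j xs κ).map Prod.snd).Nodup ∧ ∀ e ∈ (step c j xs κ).map Prod.snd,
      e ∈ (xs.map Prod.snd).toFinset ∧ ∃ r ∈ Finset.range (L + 1),
        Crowded c (xs.map Prod.snd).toFinset (hybrid κ.2.2.1 (arrivalHash src κ) r) e := by
  set g := arrivalHash src κ with hg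
  obtain ⟨h1, h2, h3, h4⟩ := putList_spec c (throwHash (κ.1, κ.2.1)) g xs hnd fun x hx => by
    rw [hg, arrivalHash, hsrc x hx]
  unfold step
  set R := putList c (throwHash (κ.1, κ.2.1)) (fun _ => []) xs
  set A := (xs.map Prod.snd).toFinset
  have hA : ∀ b, ∀ e ∈ R.1 b, e ∈ A ∧ g e = b := fun b e he =>
    ⟨List.mem_toFinset.mpr (h3 b e he).1, (h3 b e he).2.1⟩
  -- The invariant is used twice: with `A` for the crowds, and with `A` minus the overflow to see
  -- that no element both overflows and is spilled.
  have hA' : ∀ b, ∀ e ∈ R.1 b, e ∈ A.filter (fun e => e ∉ R.2.map Prod.snd) ∧ g e = b :=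
    fun b e he => ⟨Finset.mem_filter.mpr ⟨(hA b e he).1, (h3 b e he).2.2⟩, (hA b e he).2⟩
  have hinv := networkInvariant_route c κ.2.2.1 g A κ.2.2.2 R.1 h2 hA
  have hinv' := networkInvariant_route c κ.2.2.1 g _ κ.2.2.2 R.1 h2 hA'
  have hmap : (R.2 ++ (spilled (route c κ.2.2.1 κ.2.2.2 R.1)).map
      fun e => (some j, e)).map Prod.snd =
        R.2.map Prod.snd ++ spilled (route c κ.2.2.1 κ.2.2.2 R.1) := by
    simp [Function.comp_def]
  simp only [hmap]
  refine ⟨List.nodup_append'.mpr ⟨hnd.sublist (h1.map _), hinv.nodup_spilled, fun e he he' => ?_⟩,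
    fun e he => ?_⟩
  · exact (Finset.mem_filter.mp (hinv'.crowded_of_mem_spilled he').1).2 he
  · rcases List.mem_append.mp he with he | he
    -- Overflow is the case `r = 0`, where the hybrid bucket is the arrival bucket.
    · refine ⟨List.mem_toFinset.mpr ((h1.map _).subset he), 0, by simp, ?_⟩
      obtain ⟨x, hx, rfl⟩ := List.mem_map.mp he
      have : hybrid κ.2.2.1 g 0 = g := by
        funext e j
        simp [hybrid]
      rw [this]
      exact h4 x hx
    · exact hinv.crowded_of_mem_spilled he

/-! ### The numbers of arrivals at successive tables -/

lemma exists_source {α β : Type*} [Inhabited α] (xs : List (α × β)) (hnd : (xs.map Prod.snd).Nodup) :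
    ∃ src : β → α, ∀ x ∈ xs, src x.2 = x.1 := by
  classical
  refine ⟨fun e => if h : ∃ x ∈ xs, x.2 = e then h.choose.1 else default, fun x hx => ?_⟩
  have h : ∃ y ∈ xs, y.2 = x.2 := ⟨x, hx, rfl⟩
  simp only [dif_pos h]
  rw [List.inj_on_of_nodup_map hnd h.choose_spec.1 hx h.choose_spec.2]

/-- `xs` is fixed before the coins of the table are averaged, and so are the set of arrivals and the
throw that brings each one; the count of crowded elements applies. -/
lemma sum_length_step_le {L k : ℕ} (c : ℕ) (j : Fin k) (xs : List (Arrival L k))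
    (hnd : (xs.map Prod.snd).Nodup) :
    ∑ κ : TableCoins L k, ((step c j xs κ).length : ℝ) ≤
      xs.length * (L + 1) * ((xs.length : ℝ) / 2 ^ L) ^ c / c.factorial *
        Fintype.card (TableCoins L k) := by
  classical
  obtain ⟨src, hsrc⟩ := exists_source xs hnd
  have hcard : (xs.map Prod.snd).toFinset.card = xs.length := by
    rw [List.toFinset_card_of_nodup hnd, List.length_map]
  rw [← hcard]
  refine le_trans (Finset.sum_le_sum fun κ _ => ?_) (sum_card_crowded_le src c _)
  obtain ⟨h1, h2⟩ := step_spec c j xs κ hnd src hsrc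
  rw [← List.length_map (f := Prod.snd), ← List.toFinset_card_of_nodup h1]
  exact Nat.cast_le.mpr (Finset.card_le_card fun e he => by
    simp only [Finset.mem_filter]
    exact h2 e (List.mem_toFinset.mp he))

/-- Markov's inequality for a counting measure. -/
lemma card_lt_mul_le {C : Type*} [Fintype C] (f : C → ℝ) (hf : ∀ κ, 0 ≤ f κ) (a : ℝ) :
    (Nat.card {κ : C // a < f κ} : ℝ) * a ≤ ∑ κ, f κ := by
  classical
  rw [Nat.card_eq_fintype_card, Fintype.card_subtype, ← nsmul_eq_mul, ← Finset.sum_const]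
  calc _ ≤ ∑ κ ∈ Finset.univ.filter fun κ => a < f κ, f κ :=
        Finset.sum_le_sum fun κ hκ => (Finset.mem_filter.mp hκ).2.le
    _ ≤ _ := Finset.sum_le_sum_of_subset_of_nonneg (Finset.filter_subset _ _) fun κ _ _ => hf κ

/-- The bounds on the fraction of all elements that arrive at table `j`. -/
noncomputable def threshold (c : ℕ) : ℕ → ℝ
  | 0 => 1
  | j + 1 => (1 / 2) ^ c ^ j

lemma threshold_pos (c j : ℕ) : 0 < threshold c j := by
  cases j
  · exact one_pos
  · exact pow_pos (by norm_num) _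

/-- Up to the factor `(L + 1) / c!`, the ratio of the two thresholds' terms is Markov's failure
probability. Past the first table `threshold c j ^ c` equals the next threshold, and the spare
factor `threshold c j` makes the failures summable. -/
lemma threshold_pow_succ_le (c : ℕ) (hc : 2 ≤ c) (j : ℕ) :
    threshold c j ^ (c + 1) ≤ 2 * (1 / 2) ^ j * threshold c (j + 1) := by
  cases j with
  | zero => simp [threshold]
  | succ j =>
    have h1 : threshold c (j + 1) ^ c = threshold c (j + 2) := by
      simp only [threshold]
      rw [← pow_mul, pow_succ]
    rw [pow_succ, h1, mul_comm]
    refine mul_le_mul_of_nonneg_right ?_ (threshold_pos c _).le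
    have h2 : j ≤ c ^ j := (Nat.lt_pow_self (by omega)).le
    calc threshold c (j + 1) ≤ (1 / 2) ^ j := pow_le_pow_of_le_one (by norm_num) (by norm_num) h2
      _ = _ := by rw [pow_succ]; ring

lemma card_not_succeeds_le (L k c : ℕ) (hc : 2 ≤ c) (hk : L < c ^ (k - 1)) (hk0 : k ≠ 0) :
    (Nat.card {ω : Coins L k // ¬ Succeeds c ω} : ℝ) ≤
      4 * ((L + 1) / c.factorial) * Fintype.card (Coins L k) := by
  set q : ℝ := (L + 1) / c.factorial with hq
  have hq0 : 0 ≤ q := by positivity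
  let Good : ℕ → List (Arrival L k) → Prop := fun j xs =>
    (xs.map Prod.snd).Nodup ∧ (xs.length : ℝ) ≤ 2 ^ L * threshold c j
  have hinit : Good 0 (initialArrivals L k) := by
    refine ⟨?_, ?_⟩
    · simpa [initialArrivals, Function.comp_def] using List.nodup_finRange _
    · simp [initialArrivals, threshold]
  have hstep : ∀ (j : Fin k) xs, Good j xs →
      (Nat.card {κ : TableCoins L k // ¬ Good (j + 1) (step c j xs κ)} : ℝ) ≤
        2 * q * (1 / 2) ^ (j : ℕ) * Fintype.card (TableCoins L k) := by
    rintro j xs ⟨hnd, hlen⟩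
    obtain ⟨src, hsrc⟩ := exists_source xs hnd
    set a : ℝ := 2 ^ L * threshold c (j + 1) with ha
    have ha0 : 0 < a := mul_pos (by positivity) (threshold_pos _ _)
    have h1 : Nat.card {κ : TableCoins L k // ¬ Good (j + 1) (step c j xs κ)} ≤
        Nat.card {κ : TableCoins L k // a < (step c j xs κ).length} := by
      refine Nat.card_mono (Set.toFinite _) fun κ hκ => ?_
      by_contra hlt
      exact hκ ⟨(step_spec c j xs κ hnd src hsrc).1, not_lt.mp hlt⟩
    have h2 := card_lt_mul_le (fun κ : TableCoins L k => ((step c j xs κ).length : ℝ))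
      (fun _ => Nat.cast_nonneg _) a
    have h3 := h2.trans (sum_length_step_le c j xs hnd)
    refine (Nat.cast_le.mpr h1).trans (le_of_mul_le_mul_right (h3.trans ?_) ha0)
    have h4 : (xs.length : ℝ) / 2 ^ L ≤ threshold c j := by
      rwa [div_le_iff₀' (by positivity)]
    have h5 : ((xs.length : ℝ) / 2 ^ L) ^ (c + 1) ≤ 2 * (1 / 2) ^ (j : ℕ) * threshold c (j + 1) :=
      (pow_le_pow_left₀ (by positivity) h4 _).trans (threshold_pow_succ_le c hc j)
    calc xs.length * (L + 1) * ((xs.length : ℝ) / 2 ^ L) ^ c / c.factorial *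
          (Fintype.card (TableCoins L k) : ℝ)
        = ((xs.length : ℝ) / 2 ^ L) ^ (c + 1) *
            (2 ^ L * q * Fintype.card (TableCoins L k)) := by
          rw [hq, pow_succ]
          field_simp
      _ ≤ 2 * (1 / 2) ^ (j : ℕ) * threshold c (j + 1) *
            (2 ^ L * q * Fintype.card (TableCoins L k)) :=
          mul_le_mul_of_nonneg_right h5 (by positivity)
      _ = _ := by rw [ha]; ring
  have hmain := card_not_good_le k (step c) Good (fun j => 2 * q * (1 / 2) ^ j)
    (fun j => by positivity) _ hinit hstep
  have hsum : ∑ j ∈ Finset.range k, 2 * q * (1 / 2 : ℝ) ^ j ≤ 4 * q := by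
    rw [← Finset.mul_sum]
    have := sum_geometric_two_le k
    nlinarith
  have hcards : Fintype.card (Coins L k) = Fintype.card (TableCoins L k) ^ k := by
    rw [Fintype.card_congr (coinsEquiv L k), Fintype.card_fun, Fintype.card_fin]
  have hbad : Nat.card {ω : Coins L k // ¬ Succeeds c ω} ≤
      Nat.card {κ : Fin k → TableCoins L k // ¬ Good k ((List.finRange k).foldl
        (fun y j => step c j y (κ j)) (initialArrivals L k))} := by
    refine Nat.card_le_card_of_injective
      (fun ω => ⟨coinsEquiv L k ω.1, fun hgood => ω.2 ?_⟩) fun ω ω' h => ?_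
    · rw [succeeds_iff]
      have h1 := hgood.2
      change ((((List.finRange k).foldl (fun y j => step c j y (tableCoins ω.1 j))
        (initialArrivals L k)).length : ℕ) : ℝ) ≤ _ at h1
      -- A natural number of arrivals below `1` is zero.
      have h2 : (2 : ℝ) ^ L * threshold c k < 1 := by
        obtain ⟨m, rfl⟩ := Nat.exists_eq_succ_of_ne_zero hk0
        simp only [threshold, Nat.succ_eq_add_one, Nat.add_sub_cancel] at hk ⊢
        rw [one_div, inv_pow, ← div_eq_mul_inv, div_lt_one (by positivity)]
        exact pow_lt_pow_right₀ (by norm_num) hk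
      have h3 := h1.trans_lt h2
      rw [← List.length_eq_zero_iff]
      exact Nat.lt_one_iff.mp (by exact_mod_cast h3)
    · exact Subtype.ext ((coinsEquiv L k).injective (congrArg Subtype.val h))
  rw [hcards]
  push_cast
  exact (Nat.cast_le.mpr hbad).trans
    (hmain.trans (mul_le_mul_of_nonneg_right hsum (by positivity)))

lemma one_sub_le_successProb (L k c : ℕ) (hc : 2 ≤ c) (hk : L < c ^ (k - 1)) (hk0 : k ≠ 0) :
    1 - 4 * ((L + 1) / (c.factorial : ℝ)) ≤ successProb L k c := by
  have h1 := card_not_succeeds_le L k c hc hk hk0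
  have h2 : (Finset.univ.filter fun ω : Coins L k => Succeeds c ω).card +
      Nat.card {ω : Coins L k // ¬ Succeeds c ω} = Fintype.card (Coins L k) := by
    rw [Nat.card_eq_fintype_card, Fintype.card_subtype, Finset.card_filter_add_card_filter_not,
      Finset.card_univ]
  have h3 : (0 : ℝ) < Fintype.card (Coins L k) := by
    exact_mod_cast Fintype.card_pos
  unfold successProb
  rw [le_div_iff₀ h3, sub_mul, one_mul]
  have h4 : ((Finset.univ.filter fun ω : Coins L k => Succeeds c ω).card : ℝ) +
      Nat.card {ω : Coins L k // ¬ Succeeds c ω} = Fintype.card (Coins L k) := by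
    exact_mod_cast h2
  linarith


/-! ### The parameters -/

/-- Take logarithms. The exponent `2` leaves a factor `L` to spare: against `2 ^ secpar` in the
bound with `c!`, and against the base `2 ^ N` in that with `c ^ (k - 1)`. -/
lemma sq_le_pow_of_mul_logb_le {ε : ℝ} {L m N : ℕ} (hL : 1 ≤ L) (hN : 2 ≤ N * ε)
    (hm : ε * Real.logb 2 L ≤ m) : (L : ℝ) ^ 2 ≤ (2 ^ N) ^ m := by
  have hL0 : (0 : ℝ) < L := by exact_mod_cast hL
  rw [← Real.logb_le_logb (b := 2) (by norm_num) (by positivity) (by positivity), ← pow_mul,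
    Real.logb_pow, Real.logb_pow, Real.logb_self_eq_one (by norm_num), mul_one]
  have hlog : 0 ≤ Real.logb 2 L := Real.logb_nonneg (by norm_num) (by exact_mod_cast hL)
  push_cast
  calc 2 * Real.logb 2 L ≤ N * ε * Real.logb 2 L := mul_le_mul_of_nonneg_right hN hlog
    _ = N * (ε * Real.logb 2 L) := mul_assoc _ _ _
    _ ≤ N * m := mul_le_mul_of_nonneg_left hm (Nat.cast_nonneg _)

lemma exists_forall_pow_le_factorial (D : ℕ) : ∃ c₀ : ℕ, ∀ c ≥ c₀, D ^ c ≤ c.factorial := by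
  have h := FloorSemiring.tendsto_pow_div_factorial_atTop (D : ℝ)
  obtain ⟨c₀, hc₀⟩ := Filter.eventually_atTop.mp (h.eventually (gt_mem_nhds one_pos))
  refine ⟨c₀, fun c hc => ?_⟩
  have := hc₀ c hc
  rw [div_lt_one (by positivity)] at this
  exact_mod_cast this.le

lemma exists_forall_le_of_mul_logb_le {ε : ℝ} (hε : 0 < ε) (M : ℕ) :
    ∃ L₀ : ℕ, ∀ L ≥ L₀, ∀ m : ℕ, ε * Real.logb 2 L ≤ m → M ≤ m := by
  have h : Filter.Tendsto (fun L : ℕ => ε * Real.logb 2 L) Filter.atTop Filter.atTop :=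
    ((Real.tendsto_logb_atTop (by norm_num)).comp tendsto_natCast_atTop_atTop).const_mul_atTop hε
  obtain ⟨L₀, hL₀⟩ := Filter.eventually_atTop.mp (h.eventually_ge_atTop (M : ℝ))
  exact ⟨L₀, fun L hL m hm => by exact_mod_cast (hL₀ L hL).trans hm⟩

end Zigzag

theorem mainTheorem3 (ε : ℝ) (hε : 0 < ε) (secpar : ℕ) :
    ∃ n₀ : ℕ, ∀ L k c : ℕ, n₀ ≤ 2 ^ L →
      ε * Real.logb 2 (Real.logb 2 ((2 : ℝ) ^ L)) ≤ (k : ℝ) →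
      ε * Real.logb 2 (Real.logb 2 ((2 : ℝ) ^ L)) ≤ (c : ℝ) →
        1 - 1 / (2 : ℝ) ^ secpar ≤ Zigzag.successProb L k c := by
  obtain ⟨N, hN⟩ := exists_nat_ge (2 / ε)
  rw [div_le_iff₀ hε] at hN
  obtain ⟨c₀, hc₀⟩ := Zigzag.exists_forall_pow_le_factorial (2 ^ N)
  -- `2 ^ N ≤ c` lets `c ^ (k - 1)` dominate `(2 ^ N) ^ (k - 1)`; `c₀` is for the factorial; `2`
  -- gives `2 ≤ c` and `k ≠ 0`.
  obtain ⟨L₀, hL₀⟩ := Zigzag.exists_forall_le_of_mul_logb_le hε (2 ^ N + c₀ + 2)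
  refine ⟨2 ^ (L₀ + 2 ^ N + 8 * 2 ^ secpar + 1), fun L k c hn hk hc => ?_⟩
  have hL : L₀ + 2 ^ N + 8 * 2 ^ secpar + 1 ≤ L := (Nat.pow_le_pow_iff_right (by norm_num)).mp hn
  rw [Real.logb_pow, Real.logb_self_eq_one (by norm_num), mul_one] at hk hc
  have hN0 : 0 < 2 ^ N := by positivity
  have hs0 : 0 < 2 ^ secpar := by positivity
  have hc' := hL₀ L (by omega) c hc
  have hk' := hL₀ L (by omega) k hk
  have hcD : L ^ 2 ≤ (2 ^ N) ^ c := by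
    exact_mod_cast Zigzag.sq_le_pow_of_mul_logb_le (by omega) hN hc
  have hkD : L ^ 2 ≤ (2 ^ N) ^ k := by
    exact_mod_cast Zigzag.sq_le_pow_of_mul_logb_le (by omega) hN hk
  have hfact : L ^ 2 ≤ c.factorial := hcD.trans (hc₀ c (by omega))
  have hpow : L < c ^ (k - 1) := by
    refine lt_of_lt_of_le ?_ (Nat.pow_le_pow_left (by omega : 2 ^ N ≤ c) _)
    -- Passing from `k` to `k - 1` costs one factor `2 ^ N`, which is less than `L`.
    have h1 : (2 ^ N) ^ k = (2 ^ N) ^ (k - 1) * 2 ^ N := by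
      rw [← pow_succ, Nat.sub_add_cancel (by omega)]
    rw [h1, sq] at hkD
    by_contra hle
    have h2 : (2 ^ N) ^ (k - 1) * 2 ^ N < L * L :=
      Nat.mul_lt_mul_of_le_of_lt (not_lt.mp hle) (by omega) (by omega)
    omega
  refine le_trans ?_ (Zigzag.one_sub_le_successProb L k c (by omega) hpow (by omega))
  have hL1 : (1 : ℝ) ≤ L := by exact_mod_cast (by omega : 1 ≤ L)
  have hL8 : 8 * (2 : ℝ) ^ secpar ≤ L := by exact_mod_cast (by omega : 8 * 2 ^ secpar ≤ L)
  have hfact' : (L : ℝ) ^ 2 ≤ c.factorial := by exact_mod_cast hfact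
  refine sub_le_sub_left ?_ 1
  rw [← mul_div_assoc, div_le_div_iff₀ (by positivity) (by positivity), one_mul]
  calc 4 * ((L : ℝ) + 1) * 2 ^ secpar ≤ 4 * (2 * L) * 2 ^ secpar := by gcongr; linarith
    _ = L * (8 * 2 ^ secpar) := by ring
    _ ≤ L * L := by gcongr
    _ ≤ c.factorial := by rw [← sq]; exact hfact'
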